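/- Let $p, d$ be non-negative integers, and let $\mathrm{SU}(d)$ be the group of unitary complex $d\times d$ matrices of determinant $1$, regarded as an embedded real submanifold of $\mathbb{C}^{d\times d}$. Let $V:\mathbb{R}^p\to \mathrm{SU}(d)$ be infinitely differentiable, surjective, and of constant rank (that is, the real rank of the differential of $V$ at $\theta$ does not depend on $\theta$). Then for every $U\in\mathrm{SU}(d)$ and every $\theta\in\mathbb{R}^p$, the point $\theta$ is a stationary point of $f(\theta)=\frac12\|V(\theta)-U\|_{\mathrm{F}}^2$ (that is, the gradient of $f$ vanishes at $\theta$), where $\|\cdot\|_{\mathrm{F}}$ is the Frobenius norm, if and only if there is an $\alpha\in[0,2\pi)$ such that every eigenvalue of $V(\theta)^{\dagger}U$ belongs to $\{e^{i\alpha},-e^{-i\alpha}\}$. Here $\dagger$ denotes the conjugate transpose. -/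

import Mathlib

open scoped ContDiff Matrix

-- Complex matrices carry the Frobenius norm, the square root of the sum of all |a i j| ^ 2.
attribute [local instance] Matrix.frobeniusNormedAddCommGroup Matrix.frobeniusNormedSpace

/-- A map into `SU(d)` is infinitely differentiable. Since `SU(d)` is an embedded real submanifold
of the space of complex `d × d` matrices, this is real smoothness of all the matrix entries. -/
def SmoothIntoSU {p d : ℕ}
    (V : EuclideanSpace ℝ (Fin p) → Matrix.specialUnitaryGroup (Fin d) ℂ) : Prop :=
  ContDiff ℝ ∞ (fun θ => (V θ : Matrix (Fin d) (Fin d) ℂ))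

/-- The rank at `θ` of a smooth map into `SU(d)`: the real dimension of the range of its
differential. The tangent space of `SU(d)` at `V θ` is a real subspace of the space of matrices,
and so the rank may be computed there. -/
noncomputable def rankAt {p d : ℕ}
    (V : EuclideanSpace ℝ (Fin p) → Matrix.specialUnitaryGroup (Fin d) ℂ)
    (θ : EuclideanSpace ℝ (Fin p)) : ℕ :=
  Module.finrank ℝ
    (fderiv ℝ (fun η => (V η : Matrix (Fin d) (Fin d) ℂ)) θ).range

/-- The rank of the differential is the same at all points. -/
def HasConstantRank {p d : ℕ}
    (V : EuclideanSpace ℝ (Fin p) → Matrix.specialUnitaryGroup (Fin d) ℂ) : Prop :=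
  ∃ r : ℕ, ∀ θ, rankAt V θ = r

/-- The cost function `f(θ) = ½ ‖V(θ) - U‖_F²`. -/
noncomputable def cost {p d : ℕ}
    (V : EuclideanSpace ℝ (Fin p) → Matrix.specialUnitaryGroup (Fin d) ℂ)
    (U : Matrix.specialUnitaryGroup (Fin d) ℂ) (θ : EuclideanSpace ℝ (Fin p)) : ℝ :=
  (1 / 2 : ℝ) * ‖(V θ : Matrix (Fin d) (Fin d) ℂ) - (U : Matrix (Fin d) (Fin d) ℂ)‖ ^ 2

/-- A stationary point of `f`: the gradient of `f` exists there and vanishes. -/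
def IsStationaryPoint {p : ℕ} (f : EuclideanSpace ℝ (Fin p) → ℝ)
    (θ : EuclideanSpace ℝ (Fin p)) : Prop :=
  HasGradientAt f 0 θ

/-!
The cost differs by a constant from `-Re tr (Uᴴ V(θ))`, so `θ` is stationary if and only if
`Re tr (Uᴴ A) = 0` for all `A` in the range of the differential of `V` at `θ`. The range lies in the
tangent space `V(θ) su(d)`, and the heart of the matter is that it is all of it
(`mul_mem_range_fderiv_of_mem_specialSkewHermitian`). This is where surjectivity and constancy of
the rank enter. A map of constant rank `r` is locally a function of `r` variables, so its image has
Hausdorff dimension at most `r` (`ContDiff.dimH_range_le_of_finrank_range_fderiv_eq`). The image is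
`SU(d)`, whose Hausdorff dimension is at least `dim su(d)`, because the exponential map embeds a
neighbourhood of `0` in `su(d)` bi-Lipschitzly (`finrank_specialSkewHermitian_le_dimH`). Hence
`r ≥ dim su(d)`.

With `W = V(θ)ᴴ U`, stationarity thus says that `Re tr (Wᴴ X) = 0` for all `X` in `su(d)`, or that
`W - Wᴴ` is a scalar matrix (`forall_re_trace_eq_zero_iff`). Since `W` is unitary, this means that
all its eigenvalues, which lie on the unit circle, have the same imaginary part `sin α`; the two
points of the circle with that imaginary part are `exp (i α)` and `-exp (-i α)`
(`exists_sub_conjTranspose_eq_smul_one_iff`).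
-/

/-! ### The image of a map of constant rank -/

/-- Near `a`, the map `x ↦ (P (f x), Q x)`, with projections `P` onto the range and `Q` onto the
kernel of the differential at `a`, is a chart. In that chart constancy of the rank makes `f`
independent of the kernel coordinate, so the image of a neighbourhood is parametrized by an
`r`-dimensional ball. -/
theorem exists_nhds_dimH_image_le_of_finrank_range_fderiv_eq
    {E F : Type*} [NormedAddCommGroup E] [NormedSpace ℝ E] [FiniteDimensional ℝ E]
    [NormedAddCommGroup F] [NormedSpace ℝ F] [FiniteDimensional ℝ F]
    {f : E → F} (hf : ContDiff ℝ 1 f) {r : ℕ}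
    (hr : ∀ x, Module.finrank ℝ (fderiv ℝ f x).range = r) (a : E) :
    ∃ s ∈ nhds a, dimH (f '' s) ≤ r := by
  have : CompleteSpace E := FiniteDimensional.complete ℝ E
  set f' := fderiv ℝ f a
  obtain ⟨P, hP⟩ := Submodule.ClosedComplemented.of_finiteDimensional f'.range
  obtain ⟨Q, hQ⟩ := Submodule.ClosedComplemented.of_finiteDimensional f'.ker
  set g : E → f'.range × f'.ker := fun x => (P (f x), Q x)
  have hinj : Function.Injective ((P.comp f').prod Q).toLinearMap := by
    rw [← LinearMap.ker_eq_bot, LinearMap.ker_eq_bot']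
    intro v hv
    have h1 : P (f' v) = 0 := congrArg Prod.fst hv
    have h2 : Q v = 0 := congrArg Prod.snd hv
    have h3 : f' v = 0 := by
      have := hP ⟨f' v, v, rfl⟩
      rw [h1] at this
      exact (congrArg Subtype.val this).symm
    have := hQ ⟨v, h3⟩
    rw [h2] at this
    exact (congrArg Subtype.val this).symm
  have hfin : Module.finrank ℝ E = Module.finrank ℝ (f'.range × f'.ker) := by
    rw [Module.finrank_prod]
    exact (LinearMap.finrank_range_add_finrank_ker f'.toLinearMap).symm
  let G : E ≃L[ℝ] (f'.range × f'.ker) :=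
    (LinearEquiv.ofInjectiveOfFinrankEq _ hinj hfin).toContinuousLinearEquiv
  have hgc : ContDiff ℝ 1 g := (P.contDiff.comp hf).prodMk Q.contDiff
  have hgd : HasFDerivAt g (G : E →L[ℝ] (f'.range × f'.ker)) a := by
    have hfa : HasFDerivAt f f' a := (hf.differentiable one_ne_zero a).hasFDerivAt
    have : HasFDerivAt g ((P.comp f').prod Q) a :=
      (P.hasFDerivAt.comp a hfa).prodMk Q.hasFDerivAt
    exact this.congr_fderiv rfl
  have h1 : (1 : WithTop ℕ∞) ≠ 0 := one_ne_zero
  set φ := hgc.contDiffAt.toOpenPartialHomeomorph g hgd h1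
  have hψ : ContDiffAt ℝ 1 φ.symm (g a) := hgc.contDiffAt.to_localInverse hgd h1
  have haS : a ∈ φ.source := hgc.contDiffAt.mem_toOpenPartialHomeomorph_source hgd h1
  have hT : φ.target ∈ nhds (g a) := φ.open_target.mem_nhds (φ.map_source haS)
  have hev : ∀ᶠ q in nhds (g a), ContDiffAt ℝ 1 φ.symm q ∧ q ∈ φ.target :=
    (hψ.eventually (by simp)).and hT
  obtain ⟨ε, hε, hball⟩ := Metric.eventually_nhds_iff_ball.1 hev
  set B := Metric.ball (g a).1 ε
  set B' := Metric.ball (g a).2 ε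
  have hBB : ∀ y ∈ B, ∀ z ∈ B', ContDiffAt ℝ 1 φ.symm (y, z) ∧ (y, z) ∈ φ.target := by
    intro y hy z hz
    apply hball
    rw [← ball_prod_same]
    exact ⟨hy, hz⟩
  set h : f'.range × f'.ker → F := fun q => f (φ.symm q)
  have hhc : ∀ y ∈ B, ∀ z ∈ B', ContDiffAt ℝ 1 h (y, z) := fun y hy z hz =>
    hf.contDiffAt.comp (y, z) (hBB y hy z hz).1
  -- The first component of `g ∘ φ.symm = id` says that `P` composed with the differential of `h` is
  -- the first projection. So `P` maps the `r`-dimensional range of the differential of `f` onto the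
  -- `r`-dimensional space `f'.range`, hence injectively, and `P` kills the values at `(0, v)`.
  have hzero : ∀ y ∈ B, ∀ z ∈ B', ∀ v : f'.ker, fderiv ℝ h (y, z) (0, v) = 0 := by
    intro y hy z hz v
    have hd := (hhc y hy z hz).differentiableAt h1
    have hPh : P.comp (fderiv ℝ h (y, z)) = ContinuousLinearMap.fst ℝ f'.range f'.ker := by
      have e1 : HasFDerivAt (fun q => P (h q)) (P.comp (fderiv ℝ h (y, z))) (y, z) :=
        P.hasFDerivAt.comp _ hd.hasFDerivAt
      have e2 : (fun q => P (h q)) =ᶠ[nhds (y, z)] Prod.fst := by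
        filter_upwards [φ.open_target.mem_nhds (hBB y hy z hz).2] with q hq
        exact congrArg Prod.fst (φ.right_inv hq)
      exact (e1.congr_of_eventuallyEq e2.symm).unique hasFDerivAt_fst
    have hcomp : fderiv ℝ h (y, z)
        = (fderiv ℝ f (φ.symm (y, z))).comp (fderiv ℝ φ.symm (y, z)) :=
      fderiv_comp _ (hf.differentiable h1 _) ((hBB y hy z hz).1.differentiableAt h1)
    set A := fderiv ℝ f (φ.symm (y, z))
    have hsurj : Function.Surjective (P.toLinearMap.domRestrict A.range) := by
      intro w
      refine ⟨⟨fderiv ℝ h (y, z) (w, 0), ?_⟩, ?_⟩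
      · rw [hcomp]; exact ⟨_, rfl⟩
      · exact congrArg (fun T => T (w, (0 : f'.ker))) hPh
    have hinj' : Function.Injective (P.toLinearMap.domRestrict A.range) :=
      (LinearMap.injective_iff_surjective_of_finrank_eq_finrank
        ((hr _).trans (hr a).symm)).2 hsurj
    have hm : fderiv ℝ h (y, z) (0, v) ∈ A.range := by rw [hcomp]; exact ⟨_, rfl⟩
    have h0 : P (fderiv ℝ h (y, z) (0, v)) = 0 :=
      congrArg (fun T => T ((0 : f'.range), v)) hPh
    have := @hinj' ⟨_, hm⟩ 0 (by simpa using h0)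
    exact congrArg Subtype.val this
  have hz0 : (g a).2 ∈ B' := Metric.mem_ball_self hε
  have hconst : ∀ y ∈ B, ∀ z ∈ B', h (y, z) = h (y, (g a).2) := by
    intro y hy z hz
    have hd : ∀ w ∈ B', HasFDerivAt (fun w => h (y, w))
        ((fderiv ℝ h (y, w)).comp (ContinuousLinearMap.inr ℝ f'.range f'.ker)) w := fun w hw =>
      ((hhc y hy w hw).differentiableAt h1).hasFDerivAt.comp w (hasFDerivAt_prodMk_right y w)
    refine Metric.isOpen_ball.is_const_of_fderiv_eq_zero (𝕜 := ℝ) (f := fun w => h (y, w))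
      (convex_ball _ _).isPreconnected
      (fun w hw => (hd w hw).differentiableAt.differentiableWithinAt) ?_ hz hz0
    intro w hw
    rw [(hd w hw).fderiv]
    ext v
    simpa using hzero y hy w hw v
  refine ⟨φ.source ∩ g ⁻¹' (B ×ˢ B'), Filter.inter_mem (φ.open_source.mem_nhds haS)
    (hgc.continuous.continuousAt.preimage_mem_nhds (prod_mem_nhds (Metric.ball_mem_nhds _ hε)
      (Metric.ball_mem_nhds _ hε))), ?_⟩
  have hsub : f '' (φ.source ∩ g ⁻¹' (B ×ˢ B')) ⊆ (fun y => h (y, (g a).2)) '' B := by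
    rintro _ ⟨x, ⟨hx, hxy, hxz⟩, rfl⟩
    refine ⟨(g x).1, hxy, ?_⟩
    change h ((g x).1, (g a).2) = f x
    rw [← hconst _ hxy _ hxz]
    exact congrArg f (φ.left_inv hx)
  have hcd : ContDiffOn ℝ 1 (fun y => h (y, (g a).2)) B := fun y hy =>
    ((hhc y hy _ hz0).comp y (contDiff_prodMk_left _).contDiffAt).contDiffWithinAt
  calc dimH (f '' (φ.source ∩ g ⁻¹' (B ×ˢ B')))
      ≤ dimH ((fun y => h (y, (g a).2)) '' B) := dimH_mono hsub
    _ ≤ dimH B := hcd.dimH_image_le (convex_ball _ _) subset_rfl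
    _ ≤ dimH (Set.univ : Set f'.range) := dimH_mono (Set.subset_univ _)
    _ = r := by rw [Real.dimH_univ_eq_finrank, hr a]

/-- The image of a `C¹` map of constant rank `r` has Hausdorff dimension at most `r`. -/
theorem ContDiff.dimH_range_le_of_finrank_range_fderiv_eq
    {E F : Type*} [NormedAddCommGroup E] [NormedSpace ℝ E] [FiniteDimensional ℝ E]
    [NormedAddCommGroup F] [NormedSpace ℝ F] [FiniteDimensional ℝ F]
    {f : E → F} (hf : ContDiff ℝ 1 f) {r : ℕ}
    (hr : ∀ x, Module.finrank ℝ (fderiv ℝ f x).range = r) :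
    dimH (Set.range f) ≤ r := by
  have : SecondCountableTopology E := secondCountable_of_proper
  choose s hs hdim using exists_nhds_dimH_image_le_of_finrank_range_fderiv_eq hf hr
  obtain ⟨t, ht, hU⟩ := TopologicalSpace.countable_cover_nhds hs
  rw [← Set.image_univ, ← hU, Set.image_iUnion₂, dimH_bUnion ht]
  exact iSup₂_le fun x _ => hdim x

/-! ### Unitary matrices whose eigenvalues have equal imaginary parts -/

open scoped ComplexOrder in
theorem norm_eq_one_of_mulVec_eq_smul {n : Type*} [Fintype n] [DecidableEq n] {W : Matrix n n ℂ}
    (hW : Wᴴ * W = 1) {v : n → ℂ} (hv : v ≠ 0) {μ : ℂ} (h : W *ᵥ v = μ • v) : ‖μ‖ = 1 := by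
  have h1 : star (W *ᵥ v) ⬝ᵥ (W *ᵥ v) = star v ⬝ᵥ v := by
    rw [Matrix.star_mulVec, Matrix.dotProduct_mulVec, Matrix.vecMul_vecMul, hW, Matrix.vecMul_one]
  have h2 : star v ⬝ᵥ v ≠ 0 := fun h0 => hv (dotProduct_star_self_eq_zero.1 h0)
  rw [h, star_smul, smul_dotProduct, dotProduct_smul, smul_smul, smul_eq_mul] at h1
  have h3 : star μ * μ = 1 := mul_right_cancel₀ h2 (by rw [h1, one_mul])
  have h4 : ((‖μ‖ ^ 2 : ℝ) : ℂ) = 1 := by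
    rw [← h3]; push_cast; exact (Complex.conj_mul' μ).symm
  have h5 : ‖μ‖ ^ 2 = 1 := by exact_mod_cast h4
  exact (pow_eq_one_iff_of_nonneg (norm_nonneg μ) two_ne_zero).1 h5

theorem hasEigenvalue_toLin'_iff {n : Type*} [Fintype n] [DecidableEq n] {W : Matrix n n ℂ}
    {μ : ℂ} : Module.End.HasEigenvalue (Matrix.toLin' W) μ ↔ ∃ v ≠ 0, W *ᵥ v = μ • v := by
  constructor
  · intro h
    obtain ⟨v, hv⟩ := h.exists_hasEigenvector
    exact ⟨v, hv.2, by simpa using hv.apply_eq_smul⟩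
  · rintro ⟨v, hv, h⟩
    exact Module.End.hasEigenvalue_of_hasEigenvector
      (Module.End.hasEigenvector_iff.2 ⟨Module.End.mem_eigenspace_iff.2 (by simpa using h), hv⟩)

theorem sq_sub_mul_sub_one_eq_zero_of_mulVec_eq_smul {n : Type*} [Fintype n] [DecidableEq n]
    {W : Matrix n n ℂ} (hW : Wᴴ * W = 1) {c : ℂ} (hc : W - Wᴴ = c • 1) {v : n → ℂ} (hv : v ≠ 0)
    {μ : ℂ} (h : W *ᵥ v = μ • v) : μ ^ 2 - c * μ - 1 = 0 := by
  have h1 : (W - Wᴴ) *ᵥ (W *ᵥ v) = (c • (1 : Matrix n n ℂ)) *ᵥ (W *ᵥ v) := by rw [hc]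
  rw [Matrix.sub_mulVec, Matrix.mulVec_mulVec v Wᴴ W, hW, Matrix.smul_mulVec, Matrix.one_mulVec,
    Matrix.one_mulVec, h, Matrix.mulVec_smul, h, smul_smul, smul_smul] at h1
  have h2 : (μ ^ 2 - c * μ - 1) • v = 0 := by
    rw [sub_smul, sub_smul, one_smul, ← h1, sq]; abel
  exact (smul_eq_zero.1 h2).resolve_right hv

/-- For unitary `W`, an eigenvector of `W - Wᴴ` at `c` is killed by `W ^ 2 - c W - 1`, which splits
into linear factors, so that one of the two roots is an eigenvalue of `W`. -/
theorem exists_root_hasEigenvalue {n : Type*} [Fintype n] [DecidableEq n] {W : Matrix n n ℂ}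
    (hW : W * Wᴴ = 1) {c : ℂ} {v : n → ℂ} (hv : v ≠ 0) (h : (W - Wᴴ) *ᵥ v = c • v) :
    ∃ μ : ℂ, Module.End.HasEigenvalue (Matrix.toLin' W) μ ∧ μ ^ 2 - c * μ - 1 = 0 := by
  obtain ⟨δ, hδ⟩ := IsAlgClosed.exists_pow_nat_eq (c ^ 2 + 4) (n := 2) two_pos
  have h1 : W *ᵥ (W *ᵥ v) = v + c • W *ᵥ v := by
    have := congrArg (fun u => W *ᵥ u) h
    simp only [Matrix.sub_mulVec, Matrix.mulVec_sub, Matrix.mulVec_smul] at this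
    rw [Matrix.mulVec_mulVec v W Wᴴ, hW, Matrix.one_mulVec] at this
    rw [← this]; abel
  by_cases hw : W *ᵥ v = ((c - δ) / 2) • v
  · exact ⟨_, hasEigenvalue_toLin'_iff.2 ⟨v, hv, hw⟩, by linear_combination hδ / 4⟩
  · refine ⟨(c + δ) / 2, hasEigenvalue_toLin'_iff.2
      ⟨W *ᵥ v - ((c - δ) / 2) • v, sub_ne_zero.2 hw, ?_⟩, by linear_combination hδ / 4⟩
    rw [Matrix.mulVec_sub, Matrix.mulVec_smul, h1, smul_sub, smul_smul]
    have : (c + δ) / 2 * ((c - δ) / 2) = -1 := by linear_combination -hδ / 4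
    rw [this, neg_one_smul, sub_neg_eq_add, add_comm v, add_sub_right_comm, ← sub_smul]
    congr 3; ring

/-- The skew-Hermitian part of a unitary matrix is scalar if and only if all eigenvalues have the
same imaginary part `sin α`, that is, lie in `{exp (i α), -exp (-i α)}`. -/
theorem exists_sub_conjTranspose_eq_smul_one_iff {d : ℕ} {W : Matrix (Fin d) (Fin d) ℂ}
    (hW : Wᴴ * W = 1) :
    (∃ c : ℂ, W - Wᴴ = c • 1) ↔
      ∃ α ∈ Set.Ico (0 : ℝ) (2 * Real.pi), ∀ μ : ℂ,
        Module.End.HasEigenvalue (Matrix.toLin' W) μ →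
        μ = Complex.exp (Complex.I * α) ∨ μ = -Complex.exp (-(Complex.I * α)) := by
  constructor
  · rintro ⟨c, hc⟩
    by_cases hne : ∃ μ₀, Module.End.HasEigenvalue (Matrix.toLin' W) μ₀
    swap
    -- Only the `0 × 0` matrix has no eigenvalue, and then any `α` will do.
    · exact ⟨0, ⟨le_rfl, Real.two_pi_pos⟩, fun μ hμ => (hne ⟨μ, hμ⟩).elim⟩
    obtain ⟨μ₀, hμ₀⟩ := hne
    obtain ⟨v₀, hv₀, h₀⟩ := hasEigenvalue_toLin'_iff.1 hμ₀
    obtain ⟨β, hβ⟩ := (Complex.norm_eq_one_iff μ₀).1 (norm_eq_one_of_mulVec_eq_smul hW hv₀ h₀)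
    have hα : Complex.exp (Complex.I * (toIcoMod Real.two_pi_pos 0 β : ℝ)) = μ₀ := by
      rw [toIcoMod, ← hβ]
      push_cast
      rw [Complex.exp_eq_exp_iff_exists_int]
      refine ⟨-toIcoDiv Real.two_pi_pos 0 β, ?_⟩
      simp only [zsmul_eq_mul]
      push_cast
      ring
    refine ⟨toIcoMod Real.two_pi_pos 0 β, by
      simpa using toIcoMod_mem_Ico Real.two_pi_pos 0 β, fun μ hμ => ?_⟩
    obtain ⟨v, hv, h⟩ := hasEigenvalue_toLin'_iff.1 hμ
    have e₀ := sq_sub_mul_sub_one_eq_zero_of_mulVec_eq_smul hW hc hv₀ h₀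
    have e := sq_sub_mul_sub_one_eq_zero_of_mulVec_eq_smul hW hc hv h
    rw [Complex.exp_neg, hα]
    have hne : μ₀ ≠ 0 := by rintro rfl; simp at e₀
    have : (μ - μ₀) * (μ + μ₀⁻¹) = 0 := by
      field_simp
      linear_combination μ₀ * e - μ * e₀
    rcases mul_eq_zero.1 this with h | h
    · exact Or.inl (sub_eq_zero.1 h)
    · exact Or.inr (eq_neg_of_add_eq_zero_left h)
  · rintro ⟨α, -, hα⟩
    set e := Complex.exp (Complex.I * α) with he
    have hstar : star e = e⁻¹ := by
      rw [he, ← Complex.exp_neg, Complex.star_def, ← Complex.exp_conj]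
      simp
    have he0 : e ≠ 0 := Complex.exp_ne_zero _
    refine ⟨e - e⁻¹, ?_⟩
    by_contra hne
    -- Otherwise this Hermitian matrix has an eigenvalue `t ≠ 0`, and `W` an eigenvalue whose
    -- imaginary part differs from that of `e`.
    have hN : (Complex.I • (W - Wᴴ - (e - e⁻¹) • (1 : Matrix (Fin d) (Fin d) ℂ))).IsHermitian := by
      rw [Matrix.IsHermitian]
      simp only [Matrix.conjTranspose_smul, Matrix.conjTranspose_sub,
        Matrix.conjTranspose_conjTranspose, Matrix.conjTranspose_one, star_sub, hstar, star_inv₀,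
        inv_inv, Complex.star_def, Complex.conj_I, neg_smul]
      rw [← smul_neg]
      congr 1
      rw [← hstar, sub_smul, sub_smul]
      abel
    obtain ⟨v, t, ht, hv, h⟩ := hN.exists_eigenvector_of_ne_zero
      (smul_ne_zero Complex.I_ne_zero (sub_ne_zero.2 hne))
    have h1 : (W - Wᴴ) *ᵥ v = (e - e⁻¹ - Complex.I * t) • v := by
      rw [Matrix.smul_mulVec, Matrix.sub_mulVec _ (_ • 1), Matrix.smul_mulVec, Matrix.one_mulVec,
        ← Complex.coe_smul] at h
      have h' := congrArg (fun u => (-Complex.I) • u) h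
      simp only [smul_smul, neg_mul, Complex.I_mul_I, neg_neg, one_smul] at h'
      rw [sub_eq_iff_eq_add] at h'
      rw [h', ← add_smul]
      congr 1; ring
    obtain ⟨μ, hμ, hr⟩ := exists_root_hasEigenvalue (mul_eq_one_comm.1 hW) hv h1
    have hμ0 : μ ≠ 0 := by rintro rfl; simp at hr
    have hr' : μ ^ 2 - (e - e⁻¹) * μ - 1 = 0 := by
      rcases hα μ hμ with h | h
      · rw [h]; field_simp; ring
      · rw [h, Complex.exp_neg]; field_simp; ring
    have : Complex.I * t * μ = 0 := by linear_combination hr - hr'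
    simp [ht, hμ0] at this

/-! ### The Lie algebra of the special unitary group -/

/-- The Lie algebra `su(d)`: the real vector space of skew-Hermitian matrices of trace `0`. -/
def specialSkewHermitian (d : ℕ) : Submodule ℝ (Matrix (Fin d) (Fin d) ℂ) where
  carrier := {X | Xᴴ = -X ∧ X.trace = 0}
  zero_mem' := by simp
  add_mem' := by
    rintro X Y ⟨hX, hX'⟩ ⟨hY, hY'⟩
    exact ⟨by rw [Matrix.conjTranspose_add, hX, hY, neg_add], by
      rw [Matrix.trace_add, hX', hY', add_zero]⟩
  smul_mem' := by
    rintro c X ⟨hX, hX'⟩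
    exact ⟨by rw [Matrix.conjTranspose_smul, hX, star_trivial, smul_neg], by
      rw [Matrix.trace_smul, hX', smul_zero]⟩

/-- The real orthogonal complement of `su(d)` for the Frobenius inner product consists of the matrices
whose skew-Hermitian part is scalar. -/
theorem forall_re_trace_eq_zero_iff {d : ℕ} (W : Matrix (Fin d) (Fin d) ℂ) :
    (∀ X ∈ specialSkewHermitian d, (Wᴴ * X).trace.re = 0) ↔ ∃ c : ℂ, W - Wᴴ = c • 1 := by
  have key : ∀ X ∈ specialSkewHermitian d,
      2 * (Wᴴ * X).trace.re = -((W - Wᴴ) * X).trace.re := by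
    rintro X ⟨hX, -⟩
    have h1 : star (Wᴴ * X).trace = -(W * X).trace := by
      rw [← Matrix.trace_conjTranspose, Matrix.conjTranspose_mul, hX,
        Matrix.conjTranspose_conjTranspose, neg_mul, Matrix.trace_neg, Matrix.trace_mul_comm]
    have h2 := congrArg Complex.re h1
    rw [Complex.star_def, Complex.conj_re, Complex.neg_re] at h2
    rw [sub_mul, Matrix.trace_sub, Complex.sub_re]
    linarith
  constructor
  · intro h
    rcases Nat.eq_zero_or_pos d with rfl | hd
    · exact ⟨0, Subsingleton.elim _ _⟩
    have hd' : (d : ℂ) ≠ 0 := Nat.cast_ne_zero.2 hd.ne'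
    set c : ℂ := (W - Wᴴ).trace / d with hc
    refine ⟨c, ?_⟩
    have hcs : star c = -c := by
      rw [hc, star_div₀, ← Matrix.trace_conjTranspose, Matrix.conjTranspose_sub,
        Matrix.conjTranspose_conjTranspose, star_natCast, ← neg_div, ← Matrix.trace_neg, neg_sub]
    -- Testing against the traceless part `X` of `W - Wᴴ` gives `‖X‖ ^ 2 = 0`.
    set X := W - Wᴴ - c • (1 : Matrix (Fin d) (Fin d) ℂ) with hXdef
    have hX : X ∈ specialSkewHermitian d := by
      constructor
      · rw [hXdef, Matrix.conjTranspose_sub, Matrix.conjTranspose_sub, Matrix.conjTranspose_smul,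
          Matrix.conjTranspose_conjTranspose, Matrix.conjTranspose_one, hcs, neg_smul]
        abel
      · rw [hXdef, Matrix.trace_sub, Matrix.trace_smul, Matrix.trace_one, Fintype.card_fin, hc,
          smul_eq_mul, div_mul_cancel₀ _ hd', sub_self]
    have h1 := key X hX
    have h2 : W - Wᴴ = X + c • 1 := by rw [hXdef]; abel
    rw [h X hX, h2, add_mul, Matrix.smul_mul, one_mul, Matrix.trace_add, Matrix.trace_smul, hX.2,
      smul_zero, add_zero, mul_zero] at h1
    have h3 : (Xᴴ * X).trace = 0 := by
      have h4 : star (X * X).trace = (X * X).trace := by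
        rw [← Matrix.trace_conjTranspose, Matrix.conjTranspose_mul, hX.1, neg_mul_neg]
      rw [hX.1, neg_mul, Matrix.trace_neg, neg_eq_zero]
      apply Complex.ext
      · simpa using h1.symm
      · exact Complex.conj_eq_iff_im.1 h4
    have h5 : X = 0 := by
      open scoped ComplexOrder in
      exact Matrix.trace_conjTranspose_mul_self_eq_zero_iff.1 h3
    exact sub_eq_zero.1 h5
  · rintro ⟨c, hc⟩ X hX
    have := key X hX
    rw [hc, Matrix.smul_mul, one_mul, Matrix.trace_smul, hX.2] at this
    simpa using this

/-! ### The dimension of the special unitary group -/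

/-- The exponential is a bi-Lipschitz map near `0`, so it does not lower the dimension of a
neighbourhood of `0` in `S`. -/
theorem finrank_le_dimH_of_exp_mem {A : Type*} [NormedRing A] [NormedAlgebra ℝ A]
    [FiniteDimensional ℝ A] (S : Submodule ℝ A) (T : Set A)
    (h : ∀ x ∈ S, NormedSpace.exp x ∈ T) : (Module.finrank ℝ S : ENNReal) ≤ dimH T := by
  have : CompleteSpace A := FiniteDimensional.complete ℝ A
  have hexp : HasStrictFDerivAt NormedSpace.exp
      ((ContinuousLinearEquiv.refl ℝ A : A ≃L[ℝ] A) : A →L[ℝ] A) (0 : A) :=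
    hasStrictFDerivAt_exp_zero
  obtain ⟨s, hs0, hso, hs⟩ := hexp.approximates_deriv_on_open_nhds
  have hanti := hs.antilipschitz (by
    by_cases hA : Subsingleton A
    · exact Or.inl hA
    · have := not_subsingleton_iff_nontrivial.1 hA
      refine Or.inr (NNReal.half_lt_self (inv_ne_zero ?_))
      exact (ContinuousLinearEquiv.refl ℝ A).nnnorm_symm_pos.ne')
  have h1 : (Subtype.val ⁻¹' s : Set S) ∈ nhds 0 :=
    (hso.preimage continuous_subtype_val).mem_nhds hs0
  calc (Module.finrank ℝ S : ENNReal) = dimH (Subtype.val ⁻¹' s : Set S) :=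
        (Real.dimH_of_mem_nhds h1).symm
    _ = dimH ((↑) '' (Subtype.val ⁻¹' s : Set S) : Set A) :=
        (isometry_subtype_coe.dimH_image _).symm
    _ = dimH ((↑) '' (Subtype.val ⁻¹' (S : Set A) : Set s) : Set A) := by
        rw [Subtype.image_preimage_coe, Set.inter_comm]
        exact congrArg dimH (Subtype.image_preimage_coe (S : Set A) s)
    _ = dimH (Subtype.val ⁻¹' (S : Set A) : Set s) := isometry_subtype_coe.dimH_image _
    _ ≤ _ := hanti.le_dimH_image _
    _ ≤ dimH T := dimH_mono (by rintro _ ⟨x, hx, rfl⟩; exact h _ hx)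

/-- The determinant of `exp X` is computed by diagonalizing the Hermitian matrix `i X`. -/
theorem exp_mem_specialUnitaryGroup {d : ℕ} {X : Matrix (Fin d) (Fin d) ℂ}
    (hX : X ∈ specialSkewHermitian d) :
    NormedSpace.exp X ∈ Matrix.specialUnitaryGroup (Fin d) ℂ := by
  obtain ⟨h1, h2⟩ := hX
  rw [Matrix.mem_specialUnitaryGroup_iff]
  constructor
  · rw [Matrix.mem_unitaryGroup_iff, Matrix.star_eq_conjTranspose, ← Matrix.exp_conjTranspose, h1,
      ← Matrix.exp_add_of_commute _ _ (Commute.neg_right (Commute.refl X)), add_neg_cancel,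
      NormedSpace.exp_zero]
  · have hH : (Complex.I • X).IsHermitian := by
      rw [Matrix.IsHermitian, Matrix.conjTranspose_smul, h1, Complex.star_def, Complex.conj_I,
        neg_smul_neg]
    set U : Matrix (Fin d) (Fin d) ℂ := (hH.eigenvectorUnitary : Matrix (Fin d) (Fin d) ℂ)
    have hU : U * star U = 1 := Matrix.mem_unitaryGroup_iff.1 hH.eigenvectorUnitary.2
    have hUi : U⁻¹ = star U := Matrix.inv_eq_right_inv hU
    have hUu : IsUnit U := IsUnit.of_mul_eq_one _ hU
    set D : Fin d → ℂ := fun i => -Complex.I * hH.eigenvalues i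
    have hXD : X = U * Matrix.diagonal D * U⁻¹ := by
      have h3 := hH.spectral_theorem
      rw [Unitary.conjStarAlgAut_apply] at h3
      have h4 : X = (-Complex.I) • (Complex.I • X) := by simp [smul_smul]
      have h5 : Matrix.diagonal D
          = (-Complex.I) • Matrix.diagonal (RCLike.ofReal ∘ hH.eigenvalues) := by
        rw [← Matrix.diagonal_smul]; rfl
      rw [h5, hUi, Matrix.mul_smul, Matrix.smul_mul]
      exact h4.trans (congrArg _ h3)
    have hdet : ∀ M : Matrix (Fin d) (Fin d) ℂ, (U * M * U⁻¹).det = M.det := fun M => by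
      exact Matrix.det_conj hUu M
    have htr : (U * Matrix.diagonal D * U⁻¹).trace = (Matrix.diagonal D).trace := by
      rw [Matrix.trace_mul_comm, ← mul_assoc, hUi, mul_eq_one_comm.1 hU, one_mul]
    rw [hXD, htr, Matrix.trace_diagonal] at h2
    rw [hXD, Matrix.exp_conj _ _ hUu, hdet, Matrix.exp_diagonal, Matrix.det_diagonal]
    rw [show NormedSpace.exp D = fun i => Complex.exp (D i) from by
      ext i; rw [Pi.coe_exp, Complex.exp_eq_exp_ℂ], ← Complex.exp_sum, h2, Complex.exp_zero]

attribute [local instance] Matrix.frobeniusNormedRing Matrix.frobeniusNormedAlgebra in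
theorem finrank_specialSkewHermitian_le_dimH (d : ℕ) :
    (Module.finrank ℝ (specialSkewHermitian d) : ENNReal)
      ≤ dimH (Matrix.specialUnitaryGroup (Fin d) ℂ : Set (Matrix (Fin d) (Fin d) ℂ)) :=
  finrank_le_dimH_of_exp_mem (specialSkewHermitian d) _ fun _ => exp_mem_specialUnitaryGroup

/-! ### The derivative of the determinant -/

theorem differentiable_det (d : ℕ) :
    Differentiable ℝ (Matrix.det : Matrix (Fin d) (Fin d) ℂ → ℂ) := by
  have : ∀ i j, Differentiable ℝ (fun M : Matrix (Fin d) (Fin d) ℂ => M i j) := fun i j =>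
    (Matrix.entryLinearMap ℝ ℂ i j).toContinuousLinearMap.differentiable
  rw [show (Matrix.det : Matrix (Fin d) (Fin d) ℂ → ℂ) = _ from funext Matrix.det_apply]
  fun_prop

theorem fderiv_det_one {d : ℕ} (X : Matrix (Fin d) (Fin d) ℂ) :
    fderiv ℝ Matrix.det (1 : Matrix (Fin d) (Fin d) ℂ) X = X.trace := by
  have h1 : HasLineDerivAt ℝ Matrix.det (fderiv ℝ Matrix.det 1 X) (1 : Matrix (Fin d) (Fin d) ℂ) X :=
    (differentiable_det d 1).hasFDerivAt.hasLineDerivAt X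
  set p := (Matrix.det (1 + (Polynomial.X : Polynomial ℂ) • X.map Polynomial.C)).divX.divX
  have h2 : HasDerivAt (fun z : ℂ => 1 + X.trace * z + p.eval z * z ^ 2) X.trace 0 := by
    have := (((hasDerivAt_id (0 : ℂ)).const_mul X.trace).const_add 1).add
      ((p.hasDerivAt 0).mul (hasDerivAt_pow 2 (0 : ℂ)))
    exact this.congr_deriv (by simp)
  have h3 : HasDerivAt (fun t : ℝ => Matrix.det (1 + t • X)) X.trace 0 := by
    refine (HasDerivAt.comp_ofReal (z := 0) (by simpa using h2)).congr_of_eventuallyEq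
      (Filter.Eventually.of_forall fun t => ?_)
    change (1 + t • X).det = _
    rw [← Complex.coe_smul, Matrix.det_one_add_smul]
  exact HasDerivAt.unique h1 h3

/-! ### The differential of a map into the special unitary group -/

theorem conjTranspose_mul_self_of_mem_specialUnitaryGroup {d : ℕ} {A : Matrix (Fin d) (Fin d) ℂ}
    (hA : A ∈ Matrix.specialUnitaryGroup (Fin d) ℂ) : Aᴴ * A = 1 :=
  Matrix.mem_unitaryGroup_iff'.1 (Matrix.mem_specialUnitaryGroup_iff.1 hA).1

attribute [local instance] Matrix.frobeniusNormedRing Matrix.frobeniusNormedAlgebra in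
/-- The velocity of a curve in `SU(d)`, translated back to the identity, lies in `su(d)`. -/
theorem conjTranspose_mul_mem_specialSkewHermitian {d : ℕ} {γ : ℝ → Matrix (Fin d) (Fin d) ℂ}
    (hγ : ∀ t, γ t ∈ Matrix.specialUnitaryGroup (Fin d) ℂ) {γ' : Matrix (Fin d) (Fin d) ℂ} {t : ℝ}
    (h : HasDerivAt γ γ' t) : (γ t)ᴴ * γ' ∈ specialSkewHermitian d := by
  have hu := fun s => conjTranspose_mul_self_of_mem_specialUnitaryGroup (hγ s)
  constructor
  · have h1 : HasDerivAt (fun s => (γ s)ᴴ * γ s) (γ'ᴴ * γ t + (γ t)ᴴ * γ') t := h.star.mul h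
    have h2 : HasDerivAt (fun s => (γ s)ᴴ * γ s) 0 t := by
      simp_rw [hu]; exact hasDerivAt_const t _
    rw [Matrix.conjTranspose_mul, Matrix.conjTranspose_conjTranspose]
    exact eq_neg_of_add_eq_zero_left (h1.unique h2)
  · have h1 : HasDerivAt (fun s => (γ t)ᴴ * γ s) ((γ t)ᴴ * γ') t := h.const_mul _
    have h3 : HasFDerivAt Matrix.det (fderiv ℝ Matrix.det ((γ t)ᴴ * γ t)) ((γ t)ᴴ * γ t) :=
      (differentiable_det d _).hasFDerivAt
    have h2 := h3.comp_hasDerivAt t h1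
    rw [hu] at h2
    refine (fderiv_det_one _).symm.trans (h2.unique ?_)
    have h4 : (Matrix.det ∘ fun s => (γ t)ᴴ * γ s) = fun _ => (1 : ℂ) := by
      funext s
      change ((γ t)ᴴ * γ s).det = 1
      rw [Matrix.det_mul, Matrix.det_conjTranspose, (Matrix.mem_specialUnitaryGroup_iff.1 (hγ t)).2,
        (Matrix.mem_specialUnitaryGroup_iff.1 (hγ s)).2, star_one, one_mul]
    rw [h4]
    exact hasDerivAt_const t _

theorem conjTranspose_mul_fderiv_mem_specialSkewHermitian {p d : ℕ}
    {V : EuclideanSpace ℝ (Fin p) → Matrix.specialUnitaryGroup (Fin d) ℂ}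
    (hsmooth : SmoothIntoSU V) (θ v : EuclideanSpace ℝ (Fin p)) :
    (V θ : Matrix (Fin d) (Fin d) ℂ)ᴴ *
      fderiv ℝ (fun η => (V η : Matrix (Fin d) (Fin d) ℂ)) θ v ∈ specialSkewHermitian d := by
  have h1 := (ContDiff.differentiable hsmooth (by simp) θ).hasFDerivAt.hasLineDerivAt v
  have h2 := conjTranspose_mul_mem_specialSkewHermitian (fun t => (V (θ + t • v)).2) h1
  rwa [zero_smul, add_zero] at h2

/-- A surjective smooth map of constant rank `r` into `SU(d)` is a submersion: its image has
Hausdorff dimension at most `r`, so `r` is at least the dimension of `su(d)`, and the range of the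
differential, which lies in `V θ * su(d)`, has to fill that space. -/
theorem mul_mem_range_fderiv_of_mem_specialSkewHermitian {p d : ℕ}
    {V : EuclideanSpace ℝ (Fin p) → Matrix.specialUnitaryGroup (Fin d) ℂ}
    (hsmooth : SmoothIntoSU V) (hsurj : Function.Surjective V) (hrank : HasConstantRank V)
    (θ : EuclideanSpace ℝ (Fin p)) {X : Matrix (Fin d) (Fin d) ℂ}
    (hX : X ∈ specialSkewHermitian d) :
    (V θ : Matrix (Fin d) (Fin d) ℂ) * X ∈
      (fderiv ℝ (fun η => (V η : Matrix (Fin d) (Fin d) ℂ)) θ).range := by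
  obtain ⟨r, hr⟩ := hrank
  set f : EuclideanSpace ℝ (Fin p) → Matrix (Fin d) (Fin d) ℂ := fun η => V η with hf
  have hf1 : ContDiff ℝ 1 f := ContDiff.of_le hsmooth (by exact_mod_cast le_top)
  have hVV : f θ * (f θ)ᴴ = 1 := mul_eq_one_comm.1
    (conjTranspose_mul_self_of_mem_specialUnitaryGroup (V θ).2)
  have hrange : Set.range f = (Matrix.specialUnitaryGroup (Fin d) ℂ : Set _) := by
    exact (hsurj.range_comp Subtype.val).trans Subtype.range_coe
  have hle : Module.finrank ℝ (specialSkewHermitian d) ≤ r := by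
    have h1 := hf1.dimH_range_le_of_finrank_range_fderiv_eq hr
    rw [hrange] at h1
    exact_mod_cast (finrank_specialSkewHermitian_le_dimH d).trans h1
  set ℓ : Matrix (Fin d) (Fin d) ℂ →ₗ[ℝ] Matrix (Fin d) (Fin d) ℂ :=
    LinearMap.mulLeft ℝ (f θ)ᴴ
  have hinj : Function.Injective ℓ := by
    intro A B hAB
    have : f θ * ((f θ)ᴴ * A) = f θ * ((f θ)ᴴ * B) := congrArg (f θ * ·) hAB
    rwa [← mul_assoc, ← mul_assoc, hVV, one_mul, one_mul] at this
  have hmap : (fderiv ℝ f θ).range.map ℓ ≤ specialSkewHermitian d := by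
    rintro _ ⟨_, ⟨v, rfl⟩, rfl⟩
    exact conjTranspose_mul_fderiv_mem_specialSkewHermitian hsmooth θ v
  have heq : (fderiv ℝ f θ).range.map ℓ = specialSkewHermitian d := by
    apply Submodule.eq_of_le_of_finrank_le hmap
    rw [← (Submodule.equivMapOfInjective ℓ hinj _).finrank_eq]
    exact hle.trans (hr θ).ge
  rw [← heq] at hX
  obtain ⟨A, hA, rfl⟩ := hX
  have : f θ * ((f θ)ᴴ * A) = A := by rw [← mul_assoc, hVV, one_mul]
  exact this.symm ▸ hA

/-! ### Stationary points of the cost -/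

theorem frobenius_norm_sq_eq_re_trace {d : ℕ} (A : Matrix (Fin d) (Fin d) ℂ) :
    ‖A‖ ^ 2 = (Aᴴ * A).trace.re := by
  rw [Matrix.frobenius_norm_def, ← Real.sqrt_eq_rpow, Real.sq_sqrt (by positivity),
    Matrix.trace, Complex.re_sum, Finset.sum_comm]
  refine Finset.sum_congr rfl fun j _ => ?_
  rw [Matrix.diag_apply, Matrix.mul_apply, Complex.re_sum]
  refine Finset.sum_congr rfl fun i _ => ?_
  rw [Matrix.conjTranspose_apply, Complex.star_def, Complex.conj_mul']
  norm_cast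

/-- Both `V θ` and `U` are unitary, so the cost is an affine function of the matrix `V θ`. -/
theorem cost_eq {p d : ℕ} (V : EuclideanSpace ℝ (Fin p) → Matrix.specialUnitaryGroup (Fin d) ℂ)
    (U : Matrix.specialUnitaryGroup (Fin d) ℂ) (θ : EuclideanSpace ℝ (Fin p)) :
    cost V U θ = d - ((U : Matrix (Fin d) (Fin d) ℂ)ᴴ * (V θ : Matrix (Fin d) (Fin d) ℂ)).trace.re
      := by
  set A := (V θ : Matrix (Fin d) (Fin d) ℂ)
  set B := (U : Matrix (Fin d) (Fin d) ℂ)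
  have hA : Aᴴ * A = 1 := conjTranspose_mul_self_of_mem_specialUnitaryGroup (V θ).2
  have hB : Bᴴ * B = 1 := conjTranspose_mul_self_of_mem_specialUnitaryGroup U.2
  have h1 : (Aᴴ * B).trace.re = (Bᴴ * A).trace.re := by
    rw [← Complex.conj_re, ← Complex.star_def, ← Matrix.trace_conjTranspose,
      Matrix.conjTranspose_mul, Matrix.conjTranspose_conjTranspose]
  rw [cost, frobenius_norm_sq_eq_re_trace, Matrix.conjTranspose_sub, sub_mul, mul_sub, mul_sub]
  change 1 / 2 * (Aᴴ * A - Aᴴ * B - (Bᴴ * A - Bᴴ * B)).trace.re = _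
  rw [hA, hB]
  simp only [Matrix.trace_sub, Matrix.trace_one, Complex.sub_re, Fintype.card_fin,
    Complex.natCast_re, h1]
  ring

/-- Stationarity tested on the Lie algebra. The derivative of the cost along `V θ * X` is
`-Re tr (Uᴴ * V θ * X)`, and the velocities `V θ * X` with `X` in `su(d)` are exactly the values of
the differential of `V`. -/
theorem isStationaryPoint_cost_iff {p d : ℕ}
    {V : EuclideanSpace ℝ (Fin p) → Matrix.specialUnitaryGroup (Fin d) ℂ}
    (hsmooth : SmoothIntoSU V) (hsurj : Function.Surjective V) (hrank : HasConstantRank V)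
    (U : Matrix.specialUnitaryGroup (Fin d) ℂ) (θ : EuclideanSpace ℝ (Fin p)) :
    IsStationaryPoint (cost V U) θ ↔
      ∀ X ∈ specialSkewHermitian d, (((V θ : Matrix (Fin d) (Fin d) ℂ)ᴴ *
        (U : Matrix (Fin d) (Fin d) ℂ))ᴴ * X).trace.re = 0 := by
  set f : EuclideanSpace ℝ (Fin p) → Matrix (Fin d) (Fin d) ℂ := fun η => V η with hf
  have hf1 : ContDiff ℝ 1 f := ContDiff.of_le hsmooth (by exact_mod_cast le_top)
  have hVV : f θ * (f θ)ᴴ = 1 := mul_eq_one_comm.1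
    (conjTranspose_mul_self_of_mem_specialUnitaryGroup (V θ).2)
  let L : Matrix (Fin d) (Fin d) ℂ →L[ℝ] ℝ := LinearMap.toContinuousLinearMap
    (Complex.reLm ∘ₗ Matrix.traceLinearMap (Fin d) ℝ ℂ ∘ₗ
      LinearMap.mulLeft ℝ (U : Matrix (Fin d) (Fin d) ℂ)ᴴ)
  have hL : ∀ A, L A = ((U : Matrix (Fin d) (Fin d) ℂ)ᴴ * A).trace.re := fun A => rfl
  have hcost : HasFDerivAt (cost V U) (-(L.comp (fderiv ℝ f θ))) θ := by
    rw [funext (cost_eq V U)]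
    exact (L.hasFDerivAt.comp θ (hf1.differentiable one_ne_zero θ).hasFDerivAt).const_sub _
  have h1 : IsStationaryPoint (cost V U) θ ↔ ∀ v, L (fderiv ℝ f θ v) = 0 := by
    rw [IsStationaryPoint, hasGradientAt_iff_hasFDerivAt, map_zero]
    constructor
    · intro h v
      simpa using congrArg (fun T => T v) (hcost.unique h)
    · intro h
      have h0 : -(L.comp (fderiv ℝ f θ)) = 0 := by
        ext v
        simpa using h v
      rwa [h0] at hcost
  rw [h1]
  constructor
  · intro h X hX
    obtain ⟨v, hv⟩ := mul_mem_range_fderiv_of_mem_specialSkewHermitian hsmooth hsurj hrank θ hX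
    have h2 : L (f θ * X) = 0 := by rw [← h v]; exact congrArg L hv.symm
    rw [hL, ← mul_assoc] at h2
    rwa [Matrix.conjTranspose_mul, Matrix.conjTranspose_conjTranspose]
  · intro h v
    have h4 := h _ (conjTranspose_mul_fderiv_mem_specialSkewHermitian hsmooth θ v)
    rw [Matrix.conjTranspose_mul, Matrix.conjTranspose_conjTranspose, mul_assoc, ← mul_assoc (f θ),
      hVV, one_mul] at h4
    exact h4

theorem mainTheorem1 (p d : ℕ)
    (V : EuclideanSpace ℝ (Fin p) → Matrix.specialUnitaryGroup (Fin d) ℂ)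
    (hsmooth : SmoothIntoSU V) (hsurj : Function.Surjective V) (hrank : HasConstantRank V)
    (U : Matrix.specialUnitaryGroup (Fin d) ℂ) (θ : EuclideanSpace ℝ (Fin p)) :
    IsStationaryPoint (cost V U) θ ↔
      ∃ α ∈ Set.Ico (0 : ℝ) (2 * Real.pi), ∀ μ : ℂ,
        Module.End.HasEigenvalue
          (Matrix.toLin' ((V θ : Matrix (Fin d) (Fin d) ℂ)ᴴ * (U : Matrix (Fin d) (Fin d) ℂ))) μ →
        μ = Complex.exp (Complex.I * α) ∨ μ = -Complex.exp (-(Complex.I * α)) :=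
  (isStationaryPoint_cost_iff hsmooth hsurj hrank U θ).trans
    ((forall_re_trace_eq_zero_iff _).trans (exists_sub_conjTranspose_eq_smul_one_iff (by
      have hV := conjTranspose_mul_self_of_mem_specialUnitaryGroup (V θ).2
      have hU := conjTranspose_mul_self_of_mem_specialUnitaryGroup U.2
      rw [Matrix.conjTranspose_mul, Matrix.conjTranspose_conjTranspose, mul_assoc,
        ← mul_assoc (V θ : Matrix (Fin d) (Fin d) ℂ), mul_eq_one_comm.1 hV, one_mul, hU])))
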